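/- Conventions. For a smooth real function $f$ on an open subset of $\mathbb{R}^n$ write $H_f(\xi,\xi)(x)=\sum_{j,k=1}^n\frac{\partial^2 f}{\partial x_j\partial x_k}(x)\,\xi_j\xi_k$, where $x$ is a point of that subset and $\xi\in\mathbb{R}^n$. An open set $\Omega\subset\mathbb{R}^n$ with topological boundary $b\Omega$ is *smoothly bounded* if there is $r\in C^\infty(\mathbb{R}^n,\mathbb{R})$ with $\Omega=\{r<0\}$, $b\Omega=\{r=0\}$ and $\nabla r\neq 0$ in a neighborhood of $b\Omega$. If $U\subset\mathbb{R}^n$ is open, a *smooth local defining function for $\Omega$ on $U$* is a $C^\infty$ function $r:U\to\mathbb{R}$ such that $\Omega\cap U=\{x\in U: r(x)<0\}$ and $\nabla r\ne 0$ on $b\Omega\cap U$. The set $\Omega$ is *convex near $p\in b\Omega$* if there are an open neighborhood $U'$ of $p$ and a smooth local defining function $r$ for $\Omega$ on $U'$ such that $H_r(\xi,\xi)(q)\ge 0$ for all $q\in b\Omega\cap U'$ and all $\xi\in\mathbb{R}^n$ with $\langle\nabla r(q),\xi\rangle=0$. **Proposition.** Let $\Omega\subset\mathbb{R}^n$ be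 a smoothly bounded open set that is convex near $p\in b\Omega$. Let $\sigma$ be a smooth local defining function for $\Omega$ on an open neighborhood $U$ of $p$ such that $\|\nabla\sigma\|=1$ on $b\Omega\cap U$. Then there exist constants $\alpha,\beta>0$ and an open neighborhood $W\subset U$ of $p$ such that the function $$\tilde\sigma(x)=\sigma(x)+\bigl(\alpha+\beta\|x\|^2\bigr)\sigma(x)^2$$ is a smooth local defining function for $\Omega$ on $W$ and is convex on $W$ in the sense that $$H_{\tilde\sigma}(\xi,\xi)(x)\ge 0\qquad\text{for all } x\in W \text{ and } \xi\in\mathbb{R}^n.$$ -/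

import Mathlib

open scoped ContDiff Gradient Topology

noncomputable section

/-- The Hessian `H_f(ξ, ζ)(x)`: the second derivative of `f` at `x` as a bilinear form, that is,
`∑ j k, ∂²f/∂x_j∂x_k (x) ξ_j ζ_k` when `f` is `C²` near `x`. -/
def hessianForm {n : ℕ} (f : EuclideanSpace ℝ (Fin n) → ℝ) (ξ ζ x : EuclideanSpace ℝ (Fin n)) : ℝ :=
  fderiv ℝ (fderiv ℝ f) x ξ ζ

/-- `Ω` is a smoothly bounded open set: there is a smooth `r` on all of `ℝⁿ` with
`Ω = {r < 0}`, `bΩ = {r = 0}` and `∇r ≠ 0` in a neighborhood of `bΩ`. -/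
def IsSmoothlyBounded {n : ℕ} (Ω : Set (EuclideanSpace ℝ (Fin n))) : Prop :=
  ∃ r : EuclideanSpace ℝ (Fin n) → ℝ,
    ContDiff ℝ ∞ r ∧ Ω = {x | r x < 0} ∧ frontier Ω = {x | r x = 0} ∧
      ∀ᶠ x in 𝓝ˢ (frontier Ω), ∇ r x ≠ 0

/-- `r` is a smooth local defining function for `Ω` on the open set `U`. Only the values of `r`
on `U` matter. -/
structure IsLocalDefiningFunction {n : ℕ} (r : EuclideanSpace ℝ (Fin n) → ℝ)
    (Ω U : Set (EuclideanSpace ℝ (Fin n))) : Prop where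
  isOpen : IsOpen U
  smooth : ContDiffOn ℝ ∞ r U
  inter_eq : Ω ∩ U = {x | x ∈ U ∧ r x < 0}
  gradient_ne_zero : ∀ x ∈ frontier Ω ∩ U, ∇ r x ≠ 0

/-- The tangent space at `x` to the boundary of a set with local defining function `r` near `x`. -/
def boundaryTangentSpace {n : ℕ} (r : EuclideanSpace ℝ (Fin n) → ℝ)
    (x : EuclideanSpace ℝ (Fin n)) : Set (EuclideanSpace ℝ (Fin n)) :=
  {ξ | inner ℝ (∇ r x) ξ = 0}

/-- `Ω` is convex near its boundary point `p`: for some smooth local defining function `r` on an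
open neighborhood `U` of `p`, the Hessian of `r` is nonnegative on the tangent spaces to `bΩ` at
all points of `bΩ ∩ U`. -/
def IsConvexNear {n : ℕ} (Ω : Set (EuclideanSpace ℝ (Fin n))) (p : EuclideanSpace ℝ (Fin n)) :
    Prop :=
  ∃ (U : Set (EuclideanSpace ℝ (Fin n))) (r : EuclideanSpace ℝ (Fin n) → ℝ),
    p ∈ U ∧ IsLocalDefiningFunction r Ω U ∧
      ∀ q ∈ frontier Ω ∩ U, ∀ ξ ∈ boundaryTangentSpace r q, 0 ≤ hessianForm r ξ ξ q

/-- The modified function `σ̃ = σ + (α + β‖x‖²) σ²`. -/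
def modifiedDefiningFunction {n : ℕ} (σ : EuclideanSpace ℝ (Fin n) → ℝ) (α β : ℝ) :
    EuclideanSpace ℝ (Fin n) → ℝ :=
  fun x => σ x + (α + β * ‖x‖ ^ 2) * σ x ^ 2

end

/-! Fix a boundary point `q` near `p`, put `ν = ∇σ(q)` and let `S` be the Hessian of `σ` at `q`.
Since `‖∇σ‖² - 1` vanishes on the zero set of `σ`, its differential and tangential Hessian at `q`
are a common multiple of those of `σ`. This gives `S(ξ, ν) = 0` for tangential `ξ`, and the normal
derivative of the Hessian on `ξ` is `S(ν, ν) S(ξ, ξ) - ‖Sξ‖²`. Convexity makes `S` nonnegative on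
tangent vectors, so `‖Sξ‖² ≤ M S(ξ, ξ)` by Cauchy-Schwarz: at `x = q + tν` the term linear in `t` is
absorbed by `S(ξ, ξ)`, and only an `O(t²)` loss remains. As `t` is comparable to `σ(x)`,
`exists_hessian_lower_bound` follows: `H_σ(ξ, ξ) ≥ -C (σ² ‖ξ‖² + (dσ ξ)²)`.

The correction `(α + β‖x‖²) σ²` contributes both missing squares: `2(α + β‖x‖²)(dσ ξ)²` from the
square of `σ` and `2βσ²‖ξ‖²` from the Hessian of `‖x‖²`. The remaining cross term is absorbed by
completing a square (`modified_hessian_nonneg`). -/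

open Filter Set Metric

/-! ### Taylor estimates and functions vanishing on a regular level set -/

section Calculus

variable {E F : Type*} [NormedAddCommGroup E] [NormedSpace ℝ E]
  [NormedAddCommGroup F] [NormedSpace ℝ F]

/-- Second order Taylor expansion with the Peano remainder. -/
theorem ContDiffAt.eventually_abs_sub_taylor_two_le {f : E → ℝ} {q : E} (hf : ContDiffAt ℝ 2 f q)
    {ε : ℝ} (hε : 0 < ε) :
    ∀ᶠ y in 𝓝 q, |f y - f q - fderiv ℝ f q (y - q)
      - (1 / 2) * fderiv ℝ (fderiv ℝ f) q (y - q) (y - q)| ≤ ε * ‖y - q‖ ^ 2 := by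
  have hsymm : IsSymmSndFDerivAt ℝ f q := hf.isSymmSndFDerivAt (by simp)
  have hd : DifferentiableAt ℝ (fderiv ℝ f) q :=
    (hf.fderiv_right (m := 1) (by norm_num)).differentiableAt (by norm_num)
  have h1 : ∀ᶠ y in 𝓝 q, DifferentiableAt ℝ f y :=
    (hf.eventually (by simp)).mono fun y hy => hy.differentiableAt (by norm_num)
  have h2 := (hasFDerivAt_iff_isLittleO.1 hd.hasFDerivAt).def hε
  obtain ⟨δ, hδ, hball⟩ := Metric.eventually_nhds_iff_ball.1 (h1.and h2)
  filter_upwards [ball_mem_nhds q hδ] with y hy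
  set B := fderiv ℝ (fderiv ℝ f) q with hB
  -- Mean value inequality for `f` minus its quadratic part; by symmetry of `B` the derivative of
  -- `(1/2) B(z - q, z - q)` is `B(z - q)`.
  have key := (convex_closedBall q ‖y - q‖).norm_image_sub_le_of_norm_hasFDerivWithin_le'
    (f := fun z => f z - (1 / 2) * B (z - q) (z - q)) (f' := fun z => fderiv ℝ f z - B (z - q))
    (φ := fderiv ℝ f q) (C := ε * ‖y - q‖) (x := q) (y := y) ?_ ?_ (by simp)
    (by simp [dist_eq_norm])
  · simp only [sub_self, map_zero, mul_zero, sub_zero, Real.norm_eq_abs] at key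
    convert key using 1
    · congr 1; ring
    · ring
  · intro z hz
    have hz' : z ∈ ball q δ := by
      rw [mem_closedBall, ← dist_eq_norm] at hz
      exact lt_of_le_of_lt hz hy
    apply HasFDerivAt.hasFDerivWithinAt
    have hsub : HasFDerivAt (fun z : E => z - q) (ContinuousLinearMap.id ℝ E) z :=
      (hasFDerivAt_id z).sub_const q
    have hBd := (B.hasFDerivAt.comp z hsub).clm_apply hsub
    refine ((hball z hz').1.hasFDerivAt.sub (hBd.const_mul (1 / 2))).congr_fderiv ?_
    ext w
    have := hsymm w (z - q)
    simp only [← hB, map_sub, sub_apply] at this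
    simp only [one_div, Function.comp_apply, map_sub, ContinuousLinearMap.comp_id,
      sub_apply, smul_apply, add_apply, ContinuousLinearMap.flip_apply, smul_eq_mul]
    linear_combination (-1 / 2 : ℝ) * this
  · intro z hz
    have hz' : z ∈ ball q δ := by
      rw [mem_closedBall, ← dist_eq_norm] at hz
      exact lt_of_le_of_lt hz hy
    have := (hball z hz').2
    rw [sub_right_comm]
    refine this.trans ?_
    rw [mem_closedBall, dist_eq_norm] at hz
    gcongr

/-- First order Taylor expansion with a quadratic remainder, locally uniformly in both points. -/
theorem ContDiffAt.exists_norm_sub_taylor_one_le {f : E → F} {p : E} (hf : ContDiffAt ℝ 2 f p) :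
    ∃ K : ℝ, 0 < K ∧ ∃ δ > 0, ∀ x ∈ ball p δ, ∀ q ∈ ball p δ,
      ‖fderiv ℝ f x - fderiv ℝ f q‖ ≤ K * ‖x - q‖ ∧
      ‖f x - f q - fderiv ℝ f q (x - q)‖ ≤ K * ‖x - q‖ ^ 2 := by
  obtain ⟨K, t, ht, hK⟩ := (hf.fderiv_right (m := 1) (by norm_num)).exists_lipschitzOnWith
  have h1 : ∀ᶠ y in 𝓝 p, DifferentiableAt ℝ f y :=
    (hf.eventually (by simp)).mono fun y hy => hy.differentiableAt (by norm_num)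
  obtain ⟨δ, hδ, hball⟩ := Metric.eventually_nhds_iff_ball.1 (h1.and ht)
  have hL : ∀ x ∈ ball p δ, ∀ q ∈ ball p δ,
      ‖fderiv ℝ f x - fderiv ℝ f q‖ ≤ (K + 1) * ‖x - q‖ := fun x hx q hq =>
    (hK.norm_sub_le (hball x hx).2 (hball q hq).2).trans (by gcongr; linarith)
  -- `K + 1` because the Lipschitz constant `K` may be zero.
  refine ⟨K + 1, by positivity, δ, hδ, fun x hx q hq => ⟨hL x hx q hq, ?_⟩⟩
  have hseg : segment ℝ q x ⊆ ball p δ := (convex_ball p δ).segment_subset hq hx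
  have := (convex_segment q x).norm_image_sub_le_of_norm_hasFDerivWithin_le'
    (f := f) (f' := fun z => fderiv ℝ f z) (φ := fderiv ℝ f q) (C := (K + 1) * ‖x - q‖)
    (x := q) (y := x) (fun z hz => ((hball z (hseg hz)).1).hasFDerivAt.hasFDerivWithinAt) ?_
    (left_mem_segment ℝ q x) (right_mem_segment ℝ q x)
  · convert this using 1; ring
  · intro z hz
    refine (hL z (hseg hz) q hq).trans ?_
    have : ‖z - q‖ ≤ ‖x - q‖ := by
      obtain ⟨θ, hθ, rfl⟩ := (segment_eq_image' ℝ q x ▸ hz)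
      simp only [add_sub_cancel_left, norm_smul, Real.norm_eq_abs, abs_of_nonneg hθ.1]
      exact mul_le_of_le_one_left (norm_nonneg _) hθ.2
    gcongr

theorem HasFDerivAt.eventually_pos_of_pos {f : E → ℝ} {f' : E →L[ℝ] ℝ} {q v : E}
    (hf : HasFDerivAt f f' q) (hq : f q = 0) (hv : 0 < f' v) :
    ∀ᶠ s in 𝓝[>] (0 : ℝ), 0 < f (q + s • v) := by
  have h := (hf.hasLineDerivAt v).tendsto_slope_zero_right
  filter_upwards [h.eventually_const_lt hv, self_mem_nhdsWithin] with s hs hs0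
  simp only [hq, sub_zero, smul_eq_mul] at hs
  exact pos_of_mul_pos_right hs (inv_nonneg.2 (le_of_lt hs0))

/-- Tangent vectors to a regular level set are approximated by directions towards points of it. -/
theorem ContDiffAt.eventually_exists_eq_zero {σ : E → ℝ} {q ν ξ : E} (hσ : ContDiffAt ℝ 1 σ q)
    (hq : σ q = 0) (hν : 0 < fderiv ℝ σ q ν) (hξ : fderiv ℝ σ q ξ = 0) {ε : ℝ} (hε : 0 < ε) :
    ∀ᶠ s in 𝓝[>] (0 : ℝ), ∃ u : ℝ, |u| ≤ ε ∧ σ (q + s • (ξ + u • ν)) = 0 := by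
  have hd := (hσ.differentiableAt (by norm_num)).hasFDerivAt
  have h1 : ∀ᶠ s in 𝓝[>] (0 : ℝ), 0 < σ (q + s • (ξ + ε • ν)) :=
    hd.eventually_pos_of_pos hq (by simp [hξ]; positivity)
  have h2 : ∀ᶠ s in 𝓝[>] (0 : ℝ), 0 < -σ (q + s • (ξ + (-ε) • ν)) :=
    hd.neg.eventually_pos_of_pos (by simp [hq]) (by simp [hξ]; positivity)
  have h3 : ∀ᶠ y in 𝓝 q, ContinuousAt σ y :=
    (hσ.eventually (by simp)).mono fun y hy => hy.continuousAt
  obtain ⟨δ, hδ, hball⟩ := Metric.eventually_nhds_iff_ball.1 h3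
  have h4 : ∀ᶠ s in 𝓝[>] (0 : ℝ), s * (‖ξ‖ + ε * ‖ν‖) < δ := by
    have : Tendsto (fun s : ℝ => s * (‖ξ‖ + ε * ‖ν‖)) (𝓝[>] 0) (𝓝 (0 * (‖ξ‖ + ε * ‖ν‖))) :=
      (tendsto_nhdsWithin_of_tendsto_nhds tendsto_id).mul_const _
    exact this.eventually_lt_const (by simpa using hδ)
  filter_upwards [h1, h2, h4, self_mem_nhdsWithin] with s hs1 hs2 hs4 hs0
  have hs0' : 0 < s := hs0
  have hcont : ContinuousOn (fun u : ℝ => σ (q + s • (ξ + u • ν))) (Icc (-ε) ε) := by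
    intro u hu
    apply ContinuousAt.continuousWithinAt
    have hmem : q + s • (ξ + u • ν) ∈ ball q δ := by
      rw [mem_ball, dist_eq_norm, add_sub_cancel_left, norm_smul, Real.norm_of_nonneg hs0'.le]
      refine lt_of_le_of_lt ?_ hs4
      gcongr
      refine (norm_add_le _ _).trans ?_
      rw [norm_smul]
      gcongr
      exact abs_le.2 hu
    exact ContinuousAt.comp (f := fun u : ℝ => q + s • (ξ + u • ν)) (hball _ hmem)
      (by fun_prop)
  -- For small `s` the sign of `σ` differs at `u = ε` and `u = -ε`.
  obtain ⟨u, hu, hu0⟩ := intermediate_value_Icc (by linarith) hcont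
    (show (0 : ℝ) ∈ _ from ⟨by linarith, hs1.le⟩)
  exact ⟨u, abs_le.2 hu, hu0⟩

/-- If a function vanishes on a regular level set and its differential vanishes at a point of the
level set, then so does its Hessian there on tangent vectors. -/
theorem ContDiffAt.fderiv_fderiv_eq_zero_of_vanish {σ f : E → ℝ} {q ξ : E}
    (hσ : ContDiffAt ℝ 1 σ q) (hf : ContDiffAt ℝ 2 f q) (hq : σ q = 0) (hσ' : fderiv ℝ σ q ≠ 0)
    (hf' : fderiv ℝ f q = 0) (hvan : ∀ᶠ y in 𝓝 q, σ y = 0 → f y = 0)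
    (hξ : fderiv ℝ σ q ξ = 0) : fderiv ℝ (fderiv ℝ f) q ξ ξ = 0 := by
  obtain ⟨ν, hν⟩ : ∃ ν, 0 < fderiv ℝ σ q ν := by
    obtain ⟨w, hw⟩ := ContinuousLinearMap.exists_ne_zero hσ'
    rcases lt_or_gt_of_ne hw with h | h
    · exact ⟨-w, by simpa using h⟩
    · exact ⟨w, h⟩
  set B := fderiv ℝ (fderiv ℝ f) q with hB
  have hfq : f q = 0 := hvan.self_of_nhds hq
  -- At a zero `q + s • v` of `σ`, with `v` near `ξ`, Taylor's formula for `f` retains only its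
  -- quadratic term; divide by `s²`. Letting `ε → 0` then gives `B ξ ξ = 0`.
  have key : ∀ ε : ℝ, 0 < ε → ∃ u : ℝ, |u| ≤ ε ∧
      |B (ξ + u • ν) (ξ + u • ν)| ≤ 2 * ε * ‖ξ + u • ν‖ ^ 2 := by
    intro ε hε
    have h1 := hσ.eventually_exists_eq_zero hq hν hξ hε
    obtain ⟨δ, hδ, hball⟩ := Metric.eventually_nhds_iff_ball.1
      (hvan.and (hf.eventually_abs_sub_taylor_two_le hε))
    have h4 : ∀ᶠ s in 𝓝[>] (0 : ℝ), s * (‖ξ‖ + ε * ‖ν‖) < δ := by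
      have : Tendsto (fun s : ℝ => s * (‖ξ‖ + ε * ‖ν‖)) (𝓝[>] 0) (𝓝 (0 * (‖ξ‖ + ε * ‖ν‖))) :=
        (tendsto_nhdsWithin_of_tendsto_nhds tendsto_id).mul_const _
      exact this.eventually_lt_const (by simpa using hδ)
    obtain ⟨s, ⟨u, hu, hu0⟩, hs4, hs0⟩ :=
      (h1.and (h4.and self_mem_nhdsWithin)).exists
    have hs0' : 0 < s := hs0
    have hmem : q + s • (ξ + u • ν) ∈ ball q δ := by
      rw [mem_ball, dist_eq_norm, add_sub_cancel_left, norm_smul, Real.norm_of_nonneg hs0'.le]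
      refine lt_of_le_of_lt ?_ hs4
      gcongr
      refine (norm_add_le _ _).trans ?_
      rw [norm_smul]
      gcongr
      exact hu
    obtain ⟨hv, ht⟩ := hball _ hmem
    refine ⟨u, hu, ?_⟩
    set v := ξ + u • ν
    rw [hv hu0, hfq, hf', add_sub_cancel_left] at ht
    simp only [map_smul, smul_apply, smul_eq_mul, norm_smul,
      Real.norm_of_nonneg hs0'.le, zero_apply, ← hB] at ht
    have e : |0 - 0 - s * 0 - 1 / 2 * (s * (s * B v v))| = s ^ 2 * (|B v v| / 2) := by
      rw [show (0 - 0 - s * 0 - 1 / 2 * (s * (s * B v v)) : ℝ) = -(s ^ 2 * (B v v / 2)) by ring,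
        abs_neg, abs_mul, abs_div, abs_of_nonneg (sq_nonneg s), abs_two]
    have ht' : s ^ 2 * (|B v v| / 2) ≤ s ^ 2 * (ε * ‖v‖ ^ 2) := by
      rw [← e]; convert ht using 1
      ring
    have := le_of_mul_le_mul_left ht' (by positivity)
    linarith
  choose! u hu hB' using key
  have hlim : Tendsto u (𝓝[>] 0) (𝓝 0) := by
    rw [tendsto_zero_iff_abs_tendsto_zero]
    refine squeeze_zero' (Eventually.of_forall fun _ => abs_nonneg _) ?_
      (tendsto_nhdsWithin_of_tendsto_nhds tendsto_id)
    filter_upwards [self_mem_nhdsWithin] with ε hε using hu ε hε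
  have hv : Tendsto (fun ε => ξ + u ε • ν) (𝓝[>] 0) (𝓝 ξ) := by
    simpa using (hlim.smul_const ν).const_add ξ
  have hcont : Continuous fun v : E => |B v v| := by fun_prop
  have hL := (hcont.tendsto ξ).comp hv
  have hR : Tendsto (fun ε : ℝ => 2 * ε * ‖ξ + u ε • ν‖ ^ 2) (𝓝[>] 0) (𝓝 (2 * 0 * ‖ξ‖ ^ 2)) :=
    ((tendsto_nhdsWithin_of_tendsto_nhds tendsto_id).const_mul 2).mul (hv.norm.pow 2)
  have hle := le_of_tendsto_of_tendsto hL hR (by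
    filter_upwards [self_mem_nhdsWithin] with ε hε using hB' ε hε)
  simpa using hle

/-- If a function vanishes on a regular level set, then its differential and its tangential Hessian
are multiples of those of the defining function, by the same factor. -/
theorem ContDiffAt.exists_fderiv_eq_smul_of_vanish [CompleteSpace E] {σ f : E → ℝ} {q : E}
    (hσ : ContDiffAt ℝ 2 σ q) (hf : ContDiffAt ℝ 2 f q) (hq : σ q = 0) (hσ' : fderiv ℝ σ q ≠ 0)
    (hvan : ∀ᶠ y in 𝓝 q, σ y = 0 → f y = 0) :
    ∃ c : ℝ, fderiv ℝ f q = c • fderiv ℝ σ q ∧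
      ∀ ξ, fderiv ℝ σ q ξ = 0 →
        fderiv ℝ (fderiv ℝ f) q ξ ξ = c * fderiv ℝ (fderiv ℝ σ) q ξ ξ := by
  have hfq : f q = 0 := hvan.self_of_nhds hq
  -- `f` is constant on the level set, so `q` is a trivial extremum and Lagrange multipliers apply.
  have hext : IsLocalExtrOn f {x | σ x = σ q} q := by
    refine Or.inl ?_
    refine Filter.eventually_inf_principal.2 ?_
    filter_upwards [hvan] with y hy hyσ
    rw [hfq, hy (hyσ.trans hq)]
  obtain ⟨a, b, hab, h⟩ := hext.exists_multipliers_of_hasStrictFDerivAt_1d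
    (hσ.hasStrictFDerivAt (by norm_num)) (hf.hasStrictFDerivAt (by norm_num))
  have hb : b ≠ 0 := by
    rintro rfl
    rw [zero_smul, add_zero, smul_eq_zero] at h
    rcases h with rfl | h
    · exact hab rfl
    · exact hσ' h
  have hc : fderiv ℝ f q = (-(a / b)) • fderiv ℝ σ q := by
    have : b • fderiv ℝ f q = -(a • fderiv ℝ σ q) := eq_neg_of_add_eq_zero_right h
    rw [← inv_smul_smul₀ hb (fderiv ℝ f q), this, smul_neg, smul_smul, neg_smul]
    congr 2; field_simp
  refine ⟨_, hc, fun ξ hξ => ?_⟩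
  set c := -(a / b)
  have hev : ∀ᶠ y in 𝓝 q, DifferentiableAt ℝ f y ∧ DifferentiableAt ℝ σ y :=
    ((hf.eventually (by simp)).and (hσ.eventually (by simp))).mono fun y hy =>
      ⟨hy.1.differentiableAt (by norm_num), hy.2.differentiableAt (by norm_num)⟩
  have hD : fderiv ℝ (fun y => f y - c * σ y) =ᶠ[𝓝 q] fun y => fderiv ℝ f y - c • fderiv ℝ σ y := by
    filter_upwards [hev] with y hy
    exact (hy.1.hasFDerivAt.sub (hy.2.hasFDerivAt.const_mul c)).fderiv
  have hD2 : fderiv ℝ (fderiv ℝ (fun y => f y - c * σ y)) q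
      = fderiv ℝ (fderiv ℝ f) q - c • fderiv ℝ (fderiv ℝ σ) q := by
    rw [hD.fderiv_eq]
    exact (((hf.fderiv_right (m := 1) (by norm_num)).differentiableAt
      (by norm_num)).hasFDerivAt.sub ((((hσ.fderiv_right (m := 1) (by norm_num)).differentiableAt
      (by norm_num)).hasFDerivAt).const_smul c)).fderiv
  have := ContDiffAt.fderiv_fderiv_eq_zero_of_vanish (f := fun y => f y - c * σ y)
    (hσ.of_le (by norm_num)) (hf.sub (contDiffAt_const.mul hσ)) hq hσ'
    (by rw [hD.self_of_nhds]; simp [hc])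
    (by filter_upwards [hvan] with y hy hy0; simp [hy hy0, hy0]) hξ
  rw [hD2] at this
  simpa [sub_eq_zero] using this

end Calculus

/-! ### The Riccati equation for the Hessian, and the normal projection -/

section InnerProduct

variable {E : Type*} [NormedAddCommGroup E] [InnerProductSpace ℝ E]

/-- The inverse of the Riesz isomorphism of a real Hilbert space as a linear map. -/
noncomputable def rieszVector (E : Type*) [NormedAddCommGroup E] [InnerProductSpace ℝ E]
    [CompleteSpace E] : StrongDual ℝ E →L[ℝ] E :=
  LinearMap.mkContinuous
    { toFun := (InnerProductSpace.toDual ℝ E).symm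
      map_add' := fun x y => map_add _ x y
      map_smul' := fun c x => by simp } 1 (fun x => by simp)

section Complete

variable [CompleteSpace E]

theorem inner_rieszVector (φ : StrongDual ℝ E) (x : E) : inner ℝ (rieszVector E φ) x = φ x :=
  InnerProductSpace.toDual_symm_apply

theorem norm_rieszVector (φ : StrongDual ℝ E) : ‖rieszVector E φ‖ = ‖φ‖ :=
  (InnerProductSpace.toDual ℝ E).symm.norm_map φ

theorem gradient_eq_rieszVector (σ : E → ℝ) (x : E) : ∇ σ x = rieszVector E (fderiv ℝ σ x) := rfl

theorem apply_rieszVector_self (φ : StrongDual ℝ E) : φ (rieszVector E φ) = ‖φ‖ ^ 2 := by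
  rw [← inner_rieszVector, real_inner_self_eq_norm_sq, norm_rieszVector]

/-- Where the gradient of `σ` has length one along the zero set, the Hessian of `σ` has no mixed
tangential-normal part, and its tangential part satisfies a Riccati equation in the normal
direction. -/
theorem fderiv_hessian_gradient_of_norm_gradient_eq_one {σ : E → ℝ} {q ξ : E}
    (hσ : ContDiffAt ℝ 3 σ q) (hq : σ q = 0) (hN : ∀ᶠ y in 𝓝 q, σ y = 0 → ‖∇ σ y‖ = 1)
    (hξ : fderiv ℝ σ q ξ = 0) :
    fderiv ℝ (fderiv ℝ σ) q ξ (∇ σ q) = 0 ∧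
      fderiv ℝ (fderiv ℝ (fderiv ℝ σ)) q (∇ σ q) ξ ξ =
        fderiv ℝ (fderiv ℝ σ) q (∇ σ q) (∇ σ q) * fderiv ℝ (fderiv ℝ σ) q ξ ξ
          - ‖fderiv ℝ (fderiv ℝ σ) q ξ‖ ^ 2 := by
  have hDσ : ContDiffAt ℝ 2 (fderiv ℝ σ) q := hσ.fderiv_right (by norm_num)
  have hS : ContDiffAt ℝ 1 (fderiv ℝ (fderiv ℝ σ)) q := hDσ.fderiv_right (by norm_num)
  have hNc : ContDiffAt ℝ 2 (fun y => ∇ σ y) q := (rieszVector E).contDiff.contDiffAt.comp q hDσ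
  have hsymm : ∀ᶠ y in 𝓝 q, IsSymmSndFDerivAt ℝ σ y :=
    (hσ.eventually (by simp)).mono fun y hy => hy.isSymmSndFDerivAt (by simp; norm_num)
  have hNd : ∀ᶠ y in 𝓝 q, HasFDerivAt (fun y => ∇ σ y)
      (rieszVector E ∘L fderiv ℝ (fderiv ℝ σ) y) y :=
    (hDσ.eventually (by simp)).mono fun y hy =>
      (rieszVector E).hasFDerivAt.comp y (hy.differentiableAt (by norm_num)).hasFDerivAt
  set f : E → ℝ := fun y => inner ℝ (∇ σ y) (∇ σ y) - 1 with hf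
  have hfc : ContDiffAt ℝ 2 f q := (hNc.inner ℝ hNc).sub contDiffAt_const
  have hDf : fderiv ℝ f =ᶠ[𝓝 q] fun y => (2 : ℝ) • fderiv ℝ (fderiv ℝ σ) y (∇ σ y) := by
    filter_upwards [hNd, hsymm] with y hy hs
    refine (((hy.inner ℝ hy).sub_const 1).congr_fderiv ?_).fderiv
    ext η
    have := hs η (∇ σ y)
    have e (φ : StrongDual ℝ E) : fderiv ℝ σ y (rieszVector E φ) = φ (∇ σ y) := by
      rw [← inner_gradient_left, real_inner_comm, inner_rieszVector]
    simp [fderivInnerCLM_apply, e, this]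
    ring
  have hD2f : fderiv ℝ (fderiv ℝ f) q ξ ξ = 2 * (fderiv ℝ (fderiv ℝ (fderiv ℝ σ)) q ξ (∇ σ q) ξ
      + ‖fderiv ℝ (fderiv ℝ σ) q ξ‖ ^ 2) := by
    rw [hDf.fderiv_eq]
    have h : HasFDerivAt (fun y => (2 : ℝ) • fderiv ℝ (fderiv ℝ σ) y (∇ σ y)) _ q :=
      ((hS.differentiableAt (by norm_num)).hasFDerivAt.clm_apply
      hNd.self_of_nhds).const_smul (2 : ℝ)
    rw [h.fderiv, ← apply_rieszVector_self]
    have := hsymm.self_of_nhds ξ (rieszVector E (fderiv ℝ (fderiv ℝ σ) q ξ))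
    simp [this]
    ring
  have hgrad : fderiv ℝ σ q (∇ σ q) = 1 := by
    rw [← inner_gradient_left, real_inner_self_eq_norm_sq, hN.self_of_nhds hq, one_pow]
  have hne : fderiv ℝ σ q ≠ 0 := fun h => by simp [h] at hgrad
  -- Evaluating `Df = c Dσ` at `∇σ` gives `c = 2 S(ν, ν)`, at `ξ` gives `S(ν, ξ) = 0`; the Hessian
  -- identity `hc2` then becomes the Riccati equation.
  obtain ⟨c, hc, hc2⟩ := (hσ.of_le (by norm_num)).exists_fderiv_eq_smul_of_vanish hfc hq hne
    (by filter_upwards [hN] with y hy hy0; simp [hf, hy hy0])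
  rw [hDf.self_of_nhds] at hc
  have h1 := congrArg (fun φ => φ ξ) hc
  have h2 := congrArg (fun φ => φ (∇ σ q)) hc
  simp only [smul_apply, smul_eq_mul, hξ, hgrad, mul_zero, mul_one] at h1 h2
  refine ⟨by rw [hsymm.self_of_nhds ξ]; linarith, ?_⟩
  have h3 := hc2 ξ hξ
  rw [hD2f, ← h2] at h3
  have e1 : fderiv ℝ (fderiv ℝ (fderiv ℝ σ)) q (∇ σ q) ξ ξ =
      fderiv ℝ (fderiv ℝ (fderiv ℝ σ)) q ξ (∇ σ q) ξ := by
    rw [hDσ.isSymmSndFDerivAt (by simp) (∇ σ q) ξ]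
  rw [e1]
  linarith

/-- Cauchy-Schwarz for a bilinear form that is nonnegative on the orthogonal complement of a vector
it annihilates. -/
theorem norm_sq_le_mul_of_nonneg_on_orthogonal {S : E →L[ℝ] E →L[ℝ] ℝ} {ν : E} {M : ℝ}
    (hsymm : ∀ v w, S v w = S w v) (hM : 0 < M) (hS : ‖S‖ ≤ M)
    (hν : ∀ ξ, inner ℝ ν ξ = 0 → S ξ ν = 0) (hpos : ∀ ξ, inner ℝ ν ξ = 0 → 0 ≤ S ξ ξ)
    {ξ : E} (hξ : inner ℝ ν ξ = 0) : ‖S ξ‖ ^ 2 ≤ M * S ξ ξ := by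
  set w := rieszVector E (S ξ) with hw
  have hwν : inner ℝ ν w = 0 := by rw [real_inner_comm, inner_rieszVector, hν ξ hξ]
  have h1 : S ξ w = ‖S ξ‖ ^ 2 := apply_rieszVector_self _
  have h2 : S w w ≤ M * ‖S ξ‖ ^ 2 := by
    refine (le_abs_self _).trans ((S.le_opNorm₂ w w).trans ?_)
    rw [hw, norm_rieszVector, mul_assoc, ← sq]
    gcongr
  -- Here `w`, representing `S ξ`, is tangential since `S ξ ν = 0`. Expanding gives `M² S(ξ, ξ) -
  -- 2M‖Sξ‖² + S(w, w) ≥ 0`.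
  have h3 := hpos (M • ξ - w) (by simp [inner_sub_right, inner_smul_right, hξ, hwν])
  simp only [map_sub, map_smul, sub_apply, smul_apply, smul_eq_mul, hsymm w ξ, h1] at h3
  have h4 : M * ‖S ξ‖ ^ 2 ≤ M * (M * S ξ ξ) := by linarith
  exact le_of_mul_le_mul_left h4 hM

/-- A lower bound for a bilinear form `T`, the Hessian at distance `|t|` from a boundary point, in
terms of the Hessian `S` at that boundary point and its normal derivative `A`. -/
theorem hessian_lower_bound_of_riccati {S T A : E →L[ℝ] E →L[ℝ] ℝ} {ℓ : E →L[ℝ] ℝ} {ν : E}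
    {M K t : ℝ} (hsymm : ∀ v w, S v w = S w v) (hM : 0 < M) (hK : 0 < K) (hS : ‖S‖ ≤ M)
    (hν1 : ‖ν‖ = 1) (hν : ∀ ξ, inner ℝ ν ξ = 0 → S ξ ν = 0)
    (hpos : ∀ ξ, inner ℝ ν ξ = 0 → 0 ≤ S ξ ξ)
    (hA : ∀ ξ, inner ℝ ν ξ = 0 → A ξ ξ = S ν ν * S ξ ξ - ‖S ξ‖ ^ 2)
    (hTS : ‖T - S‖ ≤ K * |t|) (hTA : ‖T - S - t • A‖ ≤ K * t ^ 2) (ht1 : |t| ≤ 1)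
    (htM : 2 * M * |t| ≤ 1) (hℓ : ∀ ξ, |ℓ ξ - inner ℝ ν ξ| ≤ K * |t| * ‖ξ‖) (ξ : E) :
    -((2 * K + 2 * (M + 2 * K) * K ^ 2) * (t ^ 2 * ‖ξ‖ ^ 2) + 2 * (M + 2 * K) * ℓ ξ ^ 2) ≤
      T ξ ξ := by
  set a : ℝ := inner ℝ ν ξ with ha
  set τ : E := ξ - a • ν with hτ
  have hτν : inner ℝ ν τ = 0 := by
    rw [hτ, inner_sub_right, inner_smul_right, real_inner_self_eq_norm_sq, hν1, ha]; ring
  have hξτ : ξ = τ + a • ν := by rw [hτ]; abel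
  have hτn : ‖τ‖ ≤ ‖ξ‖ := by
    have h : ‖ξ‖ ^ 2 = ‖τ‖ ^ 2 + a ^ 2 := by
      have e : inner ℝ τ (a • ν) = 0 := by rw [inner_smul_right, real_inner_comm, hτν, mul_zero]
      rw [hξτ, norm_add_sq_real, e, norm_smul, hν1, mul_one, Real.norm_eq_abs, sq_abs]
      ring
    nlinarith [sq_nonneg a, norm_nonneg ξ, norm_nonneg τ]
  have hD : ∀ v w, |T v w - S v w| ≤ K * |t| * ‖v‖ * ‖w‖ := fun v w =>
    ((T - S).le_opNorm₂ v w).trans (by gcongr)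
  have hSττ := hpos τ hτν
  have hSνν : |S ν ν| ≤ M := by
    have := S.le_opNorm₂ ν ν
    rw [hν1] at this
    simpa using this.trans (by simpa using hS)
  have hCS := norm_sq_le_mul_of_nonneg_on_orthogonal hsymm hM hS hν hpos hτν
  -- The heart of the estimate: `|t A(τ, τ)| ≤ 2M|t| S(τ, τ) ≤ S(τ, τ)`, so no loss of order `t`
  -- survives.
  have h1 : -(K * t ^ 2 * ‖ξ‖ ^ 2) ≤ T τ τ := by
    have e : |T τ τ - S τ τ - t * A τ τ| ≤ K * t ^ 2 * ‖ξ‖ ^ 2 := by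
      refine ((T - S - t • A).le_opNorm₂ τ τ).trans ?_
      rw [mul_assoc, ← sq]
      gcongr
    have e2 : |t * A τ τ| ≤ |t| * (2 * M * S τ τ) := by
      rw [abs_mul, hA τ hτν]
      gcongr
      refine (abs_sub _ _).trans ?_
      rw [abs_mul, abs_of_nonneg hSττ, abs_of_nonneg (sq_nonneg ‖S τ‖)]
      nlinarith
    have e3 : |t| * (2 * M * S τ τ) ≤ S τ τ := by nlinarith
    have := (abs_le.1 e).1
    have := (abs_le.1 e2).1
    linarith
  have h2 : |T τ ν| ≤ K * |t| * ‖ξ‖ := by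
    have := hD τ ν
    rw [hν τ hτν, sub_zero, hν1, mul_one] at this
    exact this.trans (by gcongr)
  have h3 : |T ν τ| ≤ K * |t| * ‖ξ‖ := by
    have := hD ν τ
    rw [hsymm, hν τ hτν, sub_zero, hν1, mul_one] at this
    exact this.trans (by gcongr)
  have h4 : -(M + K) ≤ T ν ν := by
    have := hD ν ν
    rw [hν1] at this
    have h5 : K * |t| ≤ K := mul_le_of_le_one_right hK.le ht1
    have := (abs_le.1 this).1
    have := (abs_le.1 hSνν).1
    linarith
  have hT : T ξ ξ = T τ τ + a * (T τ ν + T ν τ) + a ^ 2 * T ν ν := by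
    conv_lhs => rw [hξτ]
    simp only [map_add, map_smul, add_apply, smul_apply, smul_eq_mul]
    ring
  -- `S` has no mixed part, so the mixed terms of `T` are `O(|t|)`, and the product with `a` splits
  -- into squares.
  have h5 : -(K * (a ^ 2 + t ^ 2 * ‖ξ‖ ^ 2)) ≤ a * (T τ ν + T ν τ) := by
    have e : |a * (T τ ν + T ν τ)| ≤ |a| * (K * |t| * ‖ξ‖ + K * |t| * ‖ξ‖) := by
      rw [abs_mul]
      gcongr
      exact (abs_add_le _ _).trans (add_le_add h2 h3)
    have e2 : 0 ≤ K * (|a| - |t| * ‖ξ‖) ^ 2 := by positivity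
    have := (abs_le.1 e).1
    rw [← sq_abs a, ← sq_abs t]
    linarith
  have h6 : -((M + K) * a ^ 2) ≤ a ^ 2 * T ν ν := by nlinarith [sq_nonneg a]
  have h7 : a ^ 2 ≤ 2 * ℓ ξ ^ 2 + 2 * (K ^ 2 * (t ^ 2 * ‖ξ‖ ^ 2)) := by
    have e := sq_le_sq' (abs_le.1 (hℓ ξ)).1 (abs_le.1 (hℓ ξ)).2
    rw [← ha, mul_pow, mul_pow, sq_abs] at e
    nlinarith [sq_nonneg (ℓ ξ - a + ℓ ξ)]
  have h8 : (M + 2 * K) * a ^ 2 ≤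
      (M + 2 * K) * (2 * ℓ ξ ^ 2 + 2 * (K ^ 2 * (t ^ 2 * ‖ξ‖ ^ 2))) := by gcongr
  rw [hT]
  linarith

end Complete

/-- Points near a regular zero of `σ` lie on the normal line through a nearby zero of `σ`. -/
theorem exists_eq_add_smul_gradient [FiniteDimensional ℝ E] {σ : E → ℝ} {p : E} {δ : ℝ}
    (hσ : ∀ y ∈ ball p δ, ContDiffAt ℝ 1 σ y) (hp : σ p = 0)
    (hN : ∀ y ∈ ball p δ, σ y = 0 → ∇ σ y ≠ 0) {x : E} (hx : x ∈ ball p (δ / 3)) :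
    ∃ q ∈ ball p δ, σ q = 0 ∧ ∃ t : ℝ, x = q + t • ∇ σ q := by
  have hx' : dist x p < δ / 3 := hx
  have hδ : 0 < δ := by linarith [dist_nonneg (x := x) (y := p)]
  -- A nearest point `q` of `s` to `x` satisfies `dist q p ≤ 2 * dist x p < 2δ/3 < 5δ/6`, so it is
  -- interior to the ball and Lagrange multipliers apply.
  set s : Set E := closedBall p (5 * δ / 6) ∩ σ ⁻¹' {0} with hs
  have hsub : closedBall p (5 * δ / 6) ⊆ ball p δ := closedBall_subset_ball (by linarith)
  have hcont : ContinuousOn σ (closedBall p (5 * δ / 6)) := fun y hy =>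
    (hσ y (hsub hy)).continuousAt.continuousWithinAt
  have hcl : IsClosed s := hcont.preimage_isClosed_of_isClosed isClosed_closedBall isClosed_singleton
  have hpS : p ∈ s := ⟨mem_closedBall_self (by positivity), hp⟩
  have : ProperSpace E := FiniteDimensional.proper_real E
  obtain ⟨q, hqs, hq⟩ := hcl.exists_infDist_eq_dist ⟨p, hpS⟩ x
  have hmin : ∀ y ∈ s, dist x q ≤ dist x y := fun y hy => hq ▸ infDist_le_dist_of_mem hy
  have hqb : q ∈ ball p (5 * δ / 6) := by
    have h1 := hmin p hpS
    have h2 := dist_triangle_left q p x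
    rw [mem_ball]
    linarith
  have hqδ := hsub hqs.1
  have hq0 : σ q = 0 := hqs.2
  refine ⟨q, hqδ, hq0, ?_⟩
  have hext : IsLocalExtrOn (fun y => ‖y - x‖ ^ 2) {y | σ y = σ q} q := by
    refine Or.inl (Filter.eventually_inf_principal.2 ?_)
    filter_upwards [isOpen_ball.mem_nhds hqb] with y hy hyσ
    have := hmin y ⟨ball_subset_closedBall hy, hyσ.trans hq0⟩
    rw [dist_comm x, dist_comm x, dist_eq_norm, dist_eq_norm] at this
    gcongr
  have hsq : HasStrictFDerivAt (fun y : E => ‖y - x‖ ^ 2)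
      ((2 • (innerSL ℝ (q - x))) ∘L ContinuousLinearMap.id ℝ E) q :=
    (hasStrictFDerivAt_norm_sq (q - x)).comp q ((hasStrictFDerivAt_id q).sub_const x)
  obtain ⟨a, b, hab, h⟩ := hext.exists_multipliers_of_hasStrictFDerivAt_1d
    ((hσ q hqδ).hasStrictFDerivAt (by norm_num)) hsq
  have hvec : a • ∇ σ q + (2 * b) • (q - x) = 0 := by
    refine ext_inner_right ℝ fun v => ?_
    have := congrArg (fun φ => φ v) h
    simp only [add_apply, smul_apply, ContinuousLinearMap.comp_id, innerSL_apply_apply,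
      smul_eq_mul, zero_apply, nsmul_eq_mul] at this
    rw [inner_add_left, real_inner_smul_left, real_inner_smul_left, inner_gradient_left,
      inner_zero_left]
    push_cast at this
    linarith
  have hb : b ≠ 0 := by
    rintro rfl
    simp only [mul_zero, zero_smul, add_zero, smul_eq_zero, hN q hqδ hq0, or_false] at hvec
    exact hab (by rw [hvec]; rfl)
  refine ⟨a / (2 * b), ?_⟩
  have : (2 * b) • (x - q) = a • ∇ σ q := by
    rw [← sub_eq_zero, ← neg_eq_zero, ← hvec]; module
  rw [div_eq_inv_mul, mul_smul, ← this, inv_smul_smul₀ (by simpa using hb)]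
  abel

end InnerProduct

/-! ### The Hessian lower bound off the boundary -/

section NormalCoordinates

variable {E : Type*} [NormedAddCommGroup E] [InnerProductSpace ℝ E] [FiniteDimensional ℝ E]

/-- If `‖∇σ‖ = 1` on the zero set of `σ` and its Hessian is nonnegative on tangent vectors there,
then off the zero set the Hessian is bounded below up to errors quadratic in `σ` and `∇σ`. -/
theorem exists_hessian_lower_bound [CompleteSpace E] {σ : E → ℝ} {p : E}
    (hσ : ∀ᶠ y in 𝓝 p, ContDiffAt ℝ 4 σ y) (hp : σ p = 0)
    (hN : ∀ᶠ y in 𝓝 p, σ y = 0 → ‖∇ σ y‖ = 1)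
    (hpos : ∀ᶠ y in 𝓝 p, σ y = 0 → ∀ ξ, fderiv ℝ σ y ξ = 0 →
      0 ≤ fderiv ℝ (fderiv ℝ σ) y ξ ξ) :
    ∃ C : ℝ, 0 < C ∧ ∀ᶠ x in 𝓝 p, ∀ ξ,
      -(C * (σ x ^ 2 * ‖ξ‖ ^ 2 + fderiv ℝ σ x ξ ^ 2)) ≤ fderiv ℝ (fderiv ℝ σ) x ξ ξ := by
  have hσp := hσ.self_of_nhds
  have hDσp : ContDiffAt ℝ 3 (fderiv ℝ σ) p := hσp.fderiv_right (by norm_num)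
  have hSp : ContDiffAt ℝ 2 (fderiv ℝ (fderiv ℝ σ)) p := hDσp.fderiv_right (by norm_num)
  obtain ⟨K₁, hK₁, δ₁, hδ₁, hb₁⟩ := (hσp.of_le (by norm_num)).exists_norm_sub_taylor_one_le
  obtain ⟨K₂, hK₂, δ₂, hδ₂, hb₂⟩ := (hDσp.of_le (by norm_num)).exists_norm_sub_taylor_one_le
  obtain ⟨K₃, hK₃, δ₃, hδ₃, hb₃⟩ := hSp.exists_norm_sub_taylor_one_le
  obtain ⟨δ₄, hδ₄, hb₄⟩ := Metric.eventually_nhds_iff_ball.1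
    (hσ.and (hN.eventually_nhds.and hpos))
  set K := max K₁ (max K₂ K₃) with hK
  have h1K : K₁ ≤ K := le_max_left _ _
  have h2K : K₂ ≤ K := (le_max_left _ _).trans (le_max_right _ _)
  have h3K : K₃ ≤ K := (le_max_right _ _).trans (le_max_right _ _)
  have hK0 : 0 < K := hK₁.trans_le h1K
  set M := ‖fderiv ℝ (fderiv ℝ σ) p‖ + K with hM
  have hM0 : 0 < M := by positivity
  -- The bound `2M|t| ≤ 1` absorbs the linear term; `2K|t| ≤ 1` gives `|σ x - t| ≤ |t|/2`, hence `t²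
  -- ≤ 4σ(x)²`, the source of the factor 4 in the constant.
  set R := min 1 (min (1 / (2 * M)) (1 / (2 * K))) with hR
  have hR0 : 0 < R := by positivity
  set δ := min (R / 2) (min (min δ₁ δ₂) (min δ₃ δ₄)) with hδ
  have hδ0 : 0 < δ := by positivity
  have hδR : δ ≤ R / 2 := min_le_left _ _
  have hs₁ : ball p δ ⊆ ball p δ₁ := ball_subset_ball (by simp [hδ])
  have hs₂ : ball p δ ⊆ ball p δ₂ := ball_subset_ball (by simp [hδ])
  have hs₃ : ball p δ ⊆ ball p δ₃ := ball_subset_ball (by simp [hδ])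
  have hs₄ : ball p δ ⊆ ball p δ₄ := ball_subset_ball (by simp [hδ])
  refine ⟨4 * (2 * K + 2 * (M + 2 * K) * K ^ 2) + 2 * (M + 2 * K), by positivity, ?_⟩
  filter_upwards [ball_mem_nhds p (show 0 < δ / 3 by positivity)] with x hx ξ
  obtain ⟨q, hq, hq0, t, hxt⟩ := exists_eq_add_smul_gradient (δ := δ)
    (fun y hy => (hb₄ y (hs₄ hy)).1.of_le (by norm_num)) hp
    (fun y hy hy0 h0 => by simpa [h0] using (hb₄ y (hs₄ hy)).2.1.self_of_nhds hy0) hx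
  obtain ⟨hqσ, hqN, hqpos⟩ := hb₄ q (hs₄ hq)
  have hν1 : ‖∇ σ q‖ = 1 := hqN.self_of_nhds hq0
  have hxδ : x ∈ ball p δ := ball_subset_ball (by linarith) hx
  have hxq : x - q = t • ∇ σ q := by rw [hxt]; abel
  have hxqn : ‖x - q‖ = |t| := by rw [hxq, norm_smul, hν1, mul_one, Real.norm_eq_abs]
  have htR : |t| ≤ R := by
    rw [← hxqn, ← dist_eq_norm]
    have := dist_triangle_right x q p
    have h1 : dist x p < δ := hxδ
    have h2 : dist q p < δ := hq
    linarith
  have ht1 : |t| ≤ 1 := htR.trans (min_le_left _ _)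
  have htM : 2 * M * |t| ≤ 1 := by
    have : |t| ≤ 1 / (2 * M) := htR.trans ((min_le_right _ _).trans (min_le_left _ _))
    rwa [le_div_iff₀ (by positivity), mul_comm] at this
  have htK : 2 * K * |t| ≤ 1 := by
    have : |t| ≤ 1 / (2 * K) := htR.trans ((min_le_right _ _).trans (min_le_right _ _))
    rwa [le_div_iff₀ (by positivity), mul_comm] at this
  have hR1 : R ≤ 1 := min_le_left _ _
  have hqp : ‖q - p‖ ≤ 1 := by
    rw [← dist_eq_norm]
    have h2 : dist q p < δ := hq
    linarith
  have hS : ‖fderiv ℝ (fderiv ℝ σ) q‖ ≤ M := by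
    have h1 := (hb₂ q (hs₂ hq) p (hs₂ (mem_ball_self hδ0))).1
    have h2 := norm_add_le (fderiv ℝ (fderiv ℝ σ) p)
      (fderiv ℝ (fderiv ℝ σ) q - fderiv ℝ (fderiv ℝ σ) p)
    rw [add_sub_cancel] at h2
    have h3 : K₂ * ‖q - p‖ ≤ K := (mul_le_of_le_one_right hK₂.le hqp).trans h2K
    linarith
  have hric : ∀ η, inner ℝ (∇ σ q) η = 0 → _ := fun η hη =>
    fderiv_hessian_gradient_of_norm_gradient_eq_one (ξ := η) (hqσ.of_le (by norm_num)) hq0 hqN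
      (by rwa [← inner_gradient_left])
  have key := hessian_lower_bound_of_riccati (S := fderiv ℝ (fderiv ℝ σ) q)
    (T := fderiv ℝ (fderiv ℝ σ) x) (A := fderiv ℝ (fderiv ℝ (fderiv ℝ σ)) q (∇ σ q))
    (ℓ := fderiv ℝ σ x) (ν := ∇ σ q) (M := M) (K := K) (t := t)
    (fun v w => hqσ.isSymmSndFDerivAt (by simp; norm_num) v w) hM0 hK0 hS hν1
    (fun η hη => (hric η hη).1) (fun η hη => hqpos hq0 η (by rwa [← inner_gradient_left]))
    (fun η hη => (hric η hη).2) ?_ ?_ ht1 htM ?_ ξ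
  · have hσt : |σ x - t| ≤ K * t ^ 2 := by
      have h1 := (hb₁ x (hs₁ hxδ) q (hs₁ hq)).2
      rw [hxqn, hq0, hxq, map_smul, ← inner_gradient_left, real_inner_self_eq_norm_sq, hν1,
        sq_abs] at h1
      simp only [one_pow, smul_eq_mul, mul_one, sub_zero, Real.norm_eq_abs] at h1
      exact h1.trans (by gcongr)
    have ht2 : t ^ 2 ≤ 4 * σ x ^ 2 := by
      have h1 : K * t ^ 2 ≤ |t| / 2 := by
        rw [← sq_abs]; nlinarith [abs_nonneg t]
      have h2 : |t| ≤ |σ x| + |σ x - t| := by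
        have := abs_sub (σ x) (σ x - t)
        rwa [sub_sub_cancel] at this
      have h3 : |t| ≤ 2 * |σ x| := by linarith
      calc t ^ 2 = |t| ^ 2 := (sq_abs t).symm
        _ ≤ (2 * |σ x|) ^ 2 := by gcongr
        _ = 4 * σ x ^ 2 := by rw [mul_pow, sq_abs]; norm_num
    refine le_trans (neg_le_neg ?_) key
    have h4 : (2 * K + 2 * (M + 2 * K) * K ^ 2) * (t ^ 2 * ‖ξ‖ ^ 2) ≤
        (2 * K + 2 * (M + 2 * K) * K ^ 2) * (4 * σ x ^ 2 * ‖ξ‖ ^ 2) := by gcongr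
    have h5 : 0 ≤ 2 * (M + 2 * K) * (σ x ^ 2 * ‖ξ‖ ^ 2) := by positivity
    have h6 : 0 ≤ 4 * (2 * K + 2 * (M + 2 * K) * K ^ 2) * fderiv ℝ σ x ξ ^ 2 := by positivity
    linarith
  · have h1 := (hb₂ x (hs₂ hxδ) q (hs₂ hq)).1
    rw [hxqn] at h1
    exact h1.trans (by gcongr)
  · have h1 := (hb₃ x (hs₃ hxδ) q (hs₃ hq)).2
    rw [hxqn, hxq, map_smul, sq_abs] at h1
    exact h1.trans (by gcongr)
  · intro η
    have h1 := (hb₁ x (hs₁ hxδ) q (hs₁ hq)).1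
    rw [hxqn] at h1
    rw [inner_gradient_left]
    exact ((fderiv ℝ σ x - fderiv ℝ σ q).le_opNorm η).trans
      (by gcongr; exact h1.trans (by gcongr))

end NormalCoordinates

/-! ### Local defining functions and the Hessian of the modified function -/

section DefiningFunction

variable {n : ℕ}

theorem tendsto_add_smul_nhdsGT_zero (x v : EuclideanSpace ℝ (Fin n)) :
    Tendsto (fun s : ℝ => x + s • v) (𝓝[>] 0) (𝓝 x) := by
  have : Continuous fun s : ℝ => x + s • v := by fun_prop
  exact tendsto_nhdsWithin_of_tendsto_nhds (by simpa using this.tendsto 0)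

theorem IsSmoothlyBounded.isOpen {Ω : Set (EuclideanSpace ℝ (Fin n))} (h : IsSmoothlyBounded Ω) : IsOpen Ω := by
  obtain ⟨r, hr, rfl, -⟩ := h
  exact isOpen_lt hr.continuous continuous_const

namespace IsLocalDefiningFunction

variable {r σ : EuclideanSpace ℝ (Fin n) → ℝ} {Ω U V : Set (EuclideanSpace ℝ (Fin n))} {x : EuclideanSpace ℝ (Fin n)}

theorem contDiffAt (h : IsLocalDefiningFunction r Ω U) (hx : x ∈ U) : ContDiffAt ℝ ∞ r x :=
  h.smooth.contDiffAt (h.isOpen.mem_nhds hx)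

theorem neg_iff_mem (h : IsLocalDefiningFunction r Ω U) (hx : x ∈ U) : r x < 0 ↔ x ∈ Ω :=
  ⟨fun hr => (h.inter_eq.symm.subset ⟨hx, hr⟩).1, fun hΩ => (h.inter_eq.subset ⟨hΩ, hx⟩).2⟩

theorem fderiv_ne_zero (h : IsLocalDefiningFunction r Ω U) (hx : x ∈ frontier Ω) (hxU : x ∈ U) :
    fderiv ℝ r x ≠ 0 := fun h0 =>
  h.gradient_ne_zero x ⟨hx, hxU⟩ (by rw [gradient, h0, map_zero])

theorem eq_zero_of_mem_frontier (h : IsLocalDefiningFunction r Ω U) (hΩ : IsOpen Ω)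
    (hx : x ∈ frontier Ω) (hxU : x ∈ U) : r x = 0 := by
  rw [hΩ.frontier_eq] at hx
  refine le_antisymm (not_lt.1 fun hpos => ?_) (not_lt.1 fun hneg =>
    hx.2 ((h.neg_iff_mem hxU).1 hneg))
  have h1 : ∀ᶠ y in 𝓝 x, 0 < r y ∧ y ∈ U :=
    ((h.contDiffAt hxU).continuousAt.eventually_const_lt hpos).and (h.isOpen.mem_nhds hxU)
  obtain ⟨y, hy, hyΩ⟩ := (mem_closure_iff_frequently.1 hx.1).and_eventually h1 |>.exists
  exact lt_asymm hyΩ.1 ((h.neg_iff_mem hyΩ.2).2 hy)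

theorem eventually_add_smul_mem (h : IsLocalDefiningFunction r Ω U) (hxU : x ∈ U) (h0 : r x = 0)
    {v : EuclideanSpace ℝ (Fin n)} (hv : fderiv ℝ r x v < 0) : ∀ᶠ s in 𝓝[>] (0 : ℝ), x + s • v ∈ Ω := by
  have hd := ((h.contDiffAt hxU).differentiableAt (by simp)).hasFDerivAt
  have h1 := hd.neg.eventually_pos_of_pos (v := v) (by simp [h0]) (by simpa using hv)
  have h2 : Tendsto (fun s : ℝ => x + s • v) (𝓝[>] 0) (𝓝 x) :=
    tendsto_add_smul_nhdsGT_zero _ _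
  filter_upwards [h1, h2.eventually (h.isOpen.mem_nhds hxU)] with s hs hsU
  exact (h.neg_iff_mem hsU).1 (by simpa using hs)

theorem mem_frontier_of_eq_zero (h : IsLocalDefiningFunction r Ω U) (hΩ : IsOpen Ω) (hxU : x ∈ U)
    (h0 : r x = 0) (hne : ∇ r x ≠ 0) : x ∈ frontier Ω := by
  rw [hΩ.frontier_eq]
  refine ⟨?_, fun hx => ((h.neg_iff_mem hxU).2 hx).ne h0⟩
  have h1 := h.eventually_add_smul_mem hxU h0 (v := -∇ r x) (by
    rw [map_neg, ← inner_gradient_left, neg_lt_zero]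
    exact real_inner_self_pos.2 hne)
  have h2 : Tendsto (fun s : ℝ => x + s • -∇ r x) (𝓝[>] 0) (𝓝 x) :=
    tendsto_add_smul_nhdsGT_zero _ _
  exact mem_closure_of_tendsto h2 h1

/-- A defining function may have zeros off the boundary where its gradient vanishes; near a boundary
point, continuity of the gradient excludes them. -/
theorem eventually_eq_zero_imp_mem_frontier (h : IsLocalDefiningFunction r Ω U) (hΩ : IsOpen Ω)
    (hx : x ∈ frontier Ω) (hxU : x ∈ U) : ∀ᶠ y in 𝓝 x, r y = 0 → y ∈ frontier Ω := by
  have hc : ContinuousAt (fun y => ∇ r y) x :=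
    (InnerProductSpace.toDual ℝ (EuclideanSpace ℝ (Fin n))).symm.continuous.continuousAt.comp
      ((h.contDiffAt hxU).fderiv_right (m := 0) (by simp)).continuousAt
  filter_upwards [hc.eventually_ne (h.gradient_ne_zero x ⟨hx, hxU⟩), h.isOpen.mem_nhds hxU]
    with y hy hyU hy0
  exact h.mem_frontier_of_eq_zero hΩ hyU hy0 hy

/-- Nonnegativity of the tangential Hessian does not depend on the defining function. -/
theorem hessian_nonneg_of_hessian_nonneg (hσ : IsLocalDefiningFunction σ Ω U)
    (hr : IsLocalDefiningFunction r Ω V) (hΩ : IsOpen Ω) (hx : x ∈ frontier Ω) (hxU : x ∈ U)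
    (hxV : x ∈ V) (hpos : ∀ ξ, fderiv ℝ r x ξ = 0 → 0 ≤ fderiv ℝ (fderiv ℝ r) x ξ ξ)
    {ξ : EuclideanSpace ℝ (Fin n)} (hξ : fderiv ℝ σ x ξ = 0) : 0 ≤ fderiv ℝ (fderiv ℝ σ) x ξ ξ := by
  have hσ0 := hσ.eq_zero_of_mem_frontier hΩ hx hxU
  have hr0 := hr.eq_zero_of_mem_frontier hΩ hx hxV
  have two_le : (2 : WithTop ℕ∞) ≤ ∞ := by
    exact WithTop.coe_le_coe.2 (le_top : (2 : ℕ∞) ≤ ⊤)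
  obtain ⟨c, hc, hc2⟩ := ((hσ.contDiffAt hxU).of_le two_le).exists_fderiv_eq_smul_of_vanish
    ((hr.contDiffAt hxV).of_le two_le) hσ0 (hσ.fderiv_ne_zero hx hxU) (by
      filter_upwards [hσ.eventually_eq_zero_imp_mem_frontier hΩ hx hxU, hr.isOpen.mem_nhds hxV]
        with y hy hyV hy0
      exact hr.eq_zero_of_mem_frontier hΩ (hy hy0) hyV)
  have hν : 0 < fderiv ℝ σ x (∇ σ x) := by
    rw [← inner_gradient_left]
    exact real_inner_self_pos.2 (hσ.gradient_ne_zero x ⟨hx, hxU⟩)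
  -- If `c < 0`, then moving along `-∇σ` enters `Ω` while `r` becomes positive.
  have hc0 : 0 < c := by
    rcases lt_trichotomy c 0 with h | h | h
    · have h1 := hσ.eventually_add_smul_mem hxU hσ0 (v := -∇ σ x) (by simpa using hν)
      have h2 := hr.eventually_add_smul_mem hxV hr0 (v := ∇ σ x) (by
        rw [hc, smul_apply, smul_eq_mul]; exact mul_neg_of_neg_of_pos h hν)
      have hd := ((hr.contDiffAt hxV).differentiableAt (by simp)).hasFDerivAt
      have h3 := hd.eventually_pos_of_pos (v := -∇ σ x) hr0 (by
        rw [hc, smul_apply, smul_eq_mul, map_neg]; nlinarith)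
      have h4 : Tendsto (fun s : ℝ => x + s • -∇ σ x) (𝓝[>] 0) (𝓝 x) :=
    tendsto_add_smul_nhdsGT_zero _ _
      obtain ⟨s, hs1, hs3, hsV⟩ :=
        (h1.and (h3.and (h4.eventually (hr.isOpen.mem_nhds hxV)))).exists
      exact absurd ((hr.neg_iff_mem hsV).2 hs1) hs3.not_gt
    · exact absurd (by rw [hc, h, zero_smul]) (hr.fderiv_ne_zero hx hxV)
    · exact h
  have := hpos ξ (by rw [hc, smul_apply, hξ, smul_zero])
  rw [hc2 ξ hξ] at this
  exact (mul_nonneg_iff_of_pos_left hc0).1 this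

end IsLocalDefiningFunction

theorem hasFDerivAt_modifiedDefiningFunction {σ : EuclideanSpace ℝ (Fin n) → ℝ} {x : EuclideanSpace ℝ (Fin n)} (hσ : DifferentiableAt ℝ σ x)
    (α β : ℝ) : HasFDerivAt (modifiedDefiningFunction σ α β)
      ((1 + 2 * ((α + β * ‖x‖ ^ 2) * σ x)) • fderiv ℝ σ x
        + (2 * β * σ x ^ 2) • innerSL ℝ x) x := by
  have hn : HasFDerivAt (fun y : EuclideanSpace ℝ (Fin n) => ‖y‖ ^ 2) (2 • innerSL ℝ x) x :=
    (hasStrictFDerivAt_norm_sq x).hasFDerivAt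
  refine (hσ.hasFDerivAt.add (((hn.const_mul β).const_add α).mul
    (hσ.hasFDerivAt.pow 2))).congr_fderiv ?_
  ext ξ
  simp
  ring

theorem hessianForm_modifiedDefiningFunction {σ : EuclideanSpace ℝ (Fin n) → ℝ} {x : EuclideanSpace ℝ (Fin n)} (hσ : ContDiffAt ℝ 2 σ x)
    (α β : ℝ) (ξ : EuclideanSpace ℝ (Fin n)) : hessianForm (modifiedDefiningFunction σ α β) ξ ξ x =
      (1 + 2 * ((α + β * ‖x‖ ^ 2) * σ x)) * hessianForm σ ξ ξ x
        + 2 * (α + β * ‖x‖ ^ 2) * fderiv ℝ σ x ξ ^ 2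
        + 8 * β * σ x * inner ℝ x ξ * fderiv ℝ σ x ξ + 2 * β * σ x ^ 2 * ‖ξ‖ ^ 2 := by
  have hd : ∀ᶠ y in 𝓝 x, DifferentiableAt ℝ σ y :=
    (hσ.eventually (by simp)).mono fun y hy => hy.differentiableAt (by norm_num)
  have hm : ContDiffAt ℝ 2 (modifiedDefiningFunction σ α β) x :=
    hσ.add ((contDiffAt_const.add (contDiffAt_const.mul (contDiff_norm_sq ℝ).contDiffAt)).mul
      (hσ.pow 2))
  -- With `ξ` fixed, the Hessian is the derivative of the scalar function `y ↦ Df(y) ξ`.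
  have hD {f : EuclideanSpace ℝ (Fin n) → ℝ} (hf : ContDiffAt ℝ 2 f x) :
      HasFDerivAt (fun y => fderiv ℝ f y ξ) ((fderiv ℝ (fderiv ℝ f) x).flip ξ) x := by
    have := ((hf.fderiv_right (m := 1) (by norm_num)).differentiableAt
      (by norm_num)).hasFDerivAt.clm_apply (hasFDerivAt_const ξ x)
    simpa using this
  have he : (fun y => fderiv ℝ (modifiedDefiningFunction σ α β) y ξ) =ᶠ[𝓝 x] fun y =>
      (1 + 2 * ((α + β * ‖y‖ ^ 2) * σ y)) * fderiv ℝ σ y ξ + 2 * β * σ y ^ 2 * inner ℝ y ξ := by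
    filter_upwards [hd] with y hy
    rw [(hasFDerivAt_modifiedDefiningFunction hy α β).fderiv]
    simp
  have hn : HasFDerivAt (fun y : EuclideanSpace ℝ (Fin n) => ‖y‖ ^ 2) (2 • innerSL ℝ x) x :=
    (hasStrictFDerivAt_norm_sq x).hasFDerivAt
  have hi : HasFDerivAt (fun y : EuclideanSpace ℝ (Fin n) => inner ℝ y ξ) (innerSL ℝ ξ) x :=
    ((innerSL ℝ ξ).hasFDerivAt (x := x)).congr_of_eventuallyEq
      (Eventually.of_forall fun y => real_inner_comm _ _)
  have hσx := hd.self_of_nhds.hasFDerivAt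
  have h1 := ((((((hn.const_mul β).const_add α).mul hσx).const_mul 2).const_add 1).mul
    (hD hσ)).add (((hσx.pow 2).const_mul (2 * β)).mul hi)
  have h2 := congrArg (fun φ => φ ξ) (((hD hm).congr_of_eventuallyEq he.symm).unique h1)
  simp only [ContinuousLinearMap.flip_apply] at h2
  rw [hessianForm, h2, hessianForm]
  simp
  ring

end DefiningFunction

/-! ### Choice of constants and conclusion -/

section DefiningFunction

variable {n : ℕ}

/-- The modified function is `σ` times a positive factor, and its gradient agrees with that of `σ`
where `σ = 0`. -/
theorem IsLocalDefiningFunction.modifiedDefiningFunction {σ : EuclideanSpace ℝ (Fin n) → ℝ}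
    {Ω U W : Set (EuclideanSpace ℝ (Fin n))} (h : IsLocalDefiningFunction σ Ω U) (hΩ : IsOpen Ω)
    (hW : IsOpen W) (hWU : W ⊆ U) {α β : ℝ}
    (hsmall : ∀ x ∈ W, 0 < 1 + (α + β * ‖x‖ ^ 2) * σ x) :
    IsLocalDefiningFunction (modifiedDefiningFunction σ α β) Ω W where
  isOpen := hW
  smooth := by
    have hs := h.smooth.mono hWU
    exact hs.add ((contDiffOn_const.add (contDiffOn_const.mul
      (contDiff_norm_sq ℝ).contDiffOn)).mul (hs.pow 2))
  inter_eq := by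
    ext x
    have e : _root_.modifiedDefiningFunction σ α β x = σ x * (1 + (α + β * ‖x‖ ^ 2) * σ x) := by
      rw [_root_.modifiedDefiningFunction]; ring
    constructor
    · rintro ⟨hxΩ, hxW⟩
      refine ⟨hxW, ?_⟩
      rw [e]
      exact mul_neg_of_neg_of_pos ((h.neg_iff_mem (hWU hxW)).2 hxΩ) (hsmall x hxW)
    · rintro ⟨hxW, hx⟩
      rw [e] at hx
      exact ⟨(h.neg_iff_mem (hWU hxW)).1 (neg_of_mul_neg_left hx (hsmall x hxW).le), hxW⟩
  gradient_ne_zero := by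
    rintro x ⟨hx, hxW⟩
    have h0 := h.eq_zero_of_mem_frontier hΩ hx (hWU hxW)
    have hd := hasFDerivAt_modifiedDefiningFunction
      ((h.contDiffAt (hWU hxW)).differentiableAt (by simp)) α β
    rw [gradient, hd.fderiv, h0]
    simpa [gradient] using h.gradient_ne_zero x ⟨hx, hWU hxW⟩

/-- The error terms in the Hessian of the modified defining function are absorbed by its gradient
and `‖x‖²` terms. -/
theorem modified_hessian_nonneg {H s d X i C N R α β : ℝ} (hC : 0 < C) (hβ : β = 2 * C)
    (hN : 0 ≤ N) (hNR : N ≤ R) (hα : α = 2 * C + 8 * β * R ^ 2)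
    (hs : |(α + β * N ^ 2) * s| ≤ 1 / 2) (hi : |i| ≤ N * X)
    (hH : -(C * (s ^ 2 * X ^ 2 + d ^ 2)) ≤ H) :
    0 ≤ (1 + 2 * ((α + β * N ^ 2) * s)) * H + 2 * (α + β * N ^ 2) * d ^ 2
      + 8 * β * s * i * d + 2 * β * s ^ 2 * X ^ 2 := by
  have hβ0 : 0 < β := by linarith
  obtain ⟨h1, h2⟩ := abs_le.1 hs
  have hQ : 0 ≤ C * (s ^ 2 * X ^ 2 + d ^ 2) := by positivity
  -- By `hs` the factor in front of `H` lies in `[0, 2]`.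
  have h3 : -(2 * (C * (s ^ 2 * X ^ 2 + d ^ 2))) ≤ (1 + 2 * ((α + β * N ^ 2) * s)) * H := by
    nlinarith
  have h4 : |s * i * d| ≤ |s| * (N * X) * |d| := by
    rw [abs_mul, abs_mul]; gcongr
  have h5 := mul_le_mul_of_nonneg_left (abs_le.1 h4).1 hβ0.le
  -- This square bounds the cross term by `β s² X² + 16 β N² d²`. The part `8βR²` of `α` pays for
  -- the second summand; the other `β s² X²` and the part `2C` of `α` pay for `h3`.
  have h6 : 0 ≤ β * (|s| * X - 4 * N * |d|) ^ 2 := by positivity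
  have h7 : |s| ^ 2 = s ^ 2 := sq_abs s
  have h8 : |d| ^ 2 = d ^ 2 := sq_abs d
  have h9 : β * (|s| * X - 4 * N * |d|) ^ 2 = β * s ^ 2 * X ^ 2
      - 8 * (β * (|s| * (N * X) * |d|)) + 16 * β * N ^ 2 * d ^ 2 := by
    rw [← h7, ← h8]; ring
  have h10 : 0 ≤ β * (R ^ 2 - N ^ 2) * d ^ 2 := by
    have : N ^ 2 ≤ R ^ 2 := by gcongr
    have := sub_nonneg.2 this
    positivity
  have h11 : 0 ≤ C * d ^ 2 := by positivity
  have h12 : 0 ≤ β * N ^ 2 * d ^ 2 := by positivity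
  have h13 : β * s ^ 2 * X ^ 2 = 2 * (C * (s ^ 2 * X ^ 2)) := by rw [hβ]; ring
  have h14 : α * d ^ 2 = 2 * (C * d ^ 2) + 8 * β * R ^ 2 * d ^ 2 := by rw [hα]; ring
  linarith

end DefiningFunction

theorem mainTheorem3 {n : ℕ} (Ω : Set (EuclideanSpace ℝ (Fin n))) (hΩ : IsSmoothlyBounded Ω)
    (p : EuclideanSpace ℝ (Fin n)) (hp : p ∈ frontier Ω) (hconv : IsConvexNear Ω p)
    (U : Set (EuclideanSpace ℝ (Fin n))) (hpU : p ∈ U)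
    (σ : EuclideanSpace ℝ (Fin n) → ℝ) (hσ : IsLocalDefiningFunction σ Ω U)
    (hgrad : ∀ x ∈ frontier Ω ∩ U, ‖∇ σ x‖ = 1) :
    ∃ α β : ℝ, 0 < α ∧ 0 < β ∧ ∃ W : Set (EuclideanSpace ℝ (Fin n)),
      IsOpen W ∧ p ∈ W ∧ W ⊆ U ∧
      IsLocalDefiningFunction (modifiedDefiningFunction σ α β) Ω W ∧
      ∀ x ∈ W, ∀ ξ : EuclideanSpace ℝ (Fin n),
        0 ≤ hessianForm (modifiedDefiningFunction σ α β) ξ ξ x := by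
  have hΩo := hΩ.isOpen
  obtain ⟨V, r, hpV, hr, hrpos⟩ := hconv
  have hp0 := hσ.eq_zero_of_mem_frontier hΩo hp hpU
  have hfr := hσ.eventually_eq_zero_imp_mem_frontier hΩo hp hpU
  have hU := hσ.isOpen.mem_nhds hpU
  have hsmooth (m : ℕ) : ∀ x ∈ U, ContDiffAt ℝ m σ x := fun x hx =>
    (hσ.contDiffAt hx).of_le (WithTop.coe_le_coe.2 (le_top : (m : ℕ∞) ≤ ⊤))
  obtain ⟨C, hC, hev⟩ := exists_hessian_lower_bound (σ := σ) (p := p)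
    (by filter_upwards [hU] with y hy using hsmooth 4 y hy) hp0
    (by filter_upwards [hfr, hU] with y hy hyU hy0 using hgrad y ⟨hy hy0, hyU⟩)
    (by
      filter_upwards [hfr, hU, hr.isOpen.mem_nhds hpV] with y hy hyU hyV hy0 ξ hξ
      refine hσ.hessian_nonneg_of_hessian_nonneg hr hΩo (hy hy0) hyU hyV (fun η hη => ?_) hξ
      exact hrpos y ⟨hy hy0, hyV⟩ η (inner_gradient_left.trans hη))
  set N := ‖p‖ + 1 with hN
  set β := 2 * C with hβ
  set α := 2 * C + 8 * β * N ^ 2 with hα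
  -- With `α` and `β` already fixed, `σ p = 0` makes this product small on a suitable `W`.
  have hcont : ContinuousAt (fun x => (α + β * ‖x‖ ^ 2) * σ x) p :=
    ContinuousAt.mul (by fun_prop) (hσ.contDiffAt hpU).continuousAt
  have hsmall : ∀ᶠ x in 𝓝 p, |(α + β * ‖x‖ ^ 2) * σ x| < 1 / 2 := by
    refine hcont.abs.eventually_lt_const ?_
    simp [hp0]
  have hnorm : ∀ᶠ x in 𝓝 p, ‖x‖ < N :=
    continuous_norm.continuousAt.eventually_lt_const (by simp [hN])
  obtain ⟨W, hWsub, hWo, hpW⟩ := _root_.eventually_nhds_iff.1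
    (hev.and (hsmall.and (hnorm.and (hσ.isOpen.eventually_mem hpU))))
  refine ⟨α, β, by positivity, by positivity, W, hWo, hpW, fun x hx => (hWsub x hx).2.2.2, ?_, ?_⟩
  · refine hσ.modifiedDefiningFunction hΩo hWo (fun x hx => (hWsub x hx).2.2.2) fun x hx => ?_
    have := (abs_lt.1 (hWsub x hx).2.1).1
    linarith
  · intro x hx ξ
    obtain ⟨hx1, hx2, hx3, hxU⟩ := hWsub x hx
    rw [hessianForm_modifiedDefiningFunction (hsmooth 2 x hxU)]
    exact modified_hessian_nonneg hC hβ (norm_nonneg x) hx3.le hα hx2.le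
      (abs_real_inner_le_norm x ξ) (hx1 ξ)
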